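/- Let $\mathcal H=\bigotimes_{i=1}^N\mathbb C^{d_i}$, let $|\psi\rangle\in\mathcal H$ be a unit vector, and let $\mathcal N_1,\dots,\mathcal N_K\subseteq\{1,\dots,N\}$ be a finite list of sets of subsystems (neighborhoods). For a neighborhood $\mathcal N_k$ write $\mathcal H\simeq\mathcal H_{\mathcal N_k}\otimes\mathcal H_{\overline{\mathcal N}_k}$, where $\mathcal H_{\mathcal N_k}=\bigotimes_{i\in\mathcal N_k}\mathbb C^{d_i}$ and $\mathcal H_{\overline{\mathcal N}_k}=\bigotimes_{i\notin\mathcal N_k}\mathbb C^{d_i}$. Define the unitary stabilizer group $$\mathcal U_{|\psi\rangle}=\{U\in\mathcal U(\mathcal H)\;:\;U|\psi\rangle\langle\psi|U^\dagger=|\psi\rangle\langle\psi|\}$$ and the neighborhood unitary stabilizer groups $$\mathcal U_{\mathcal N_k,|\psi\rangle}=\{U\in\mathcal U(\mathcal H_{\mathcal N_k})\otimes\mathbb I_{\overline{\mathcal N}_k}\;:\;U|\psi\rangle\langle\psi|U^\dagger=|\psi\rangle\langle\psi|\},$$ with Lie algebras $\mathfrak u_{|\psi\rangle}$ and $\mathfrak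 u_{\mathcal N_k,|\psi\rangle}$ respectively, where the Lie algebra of a matrix group $G$ is the real Lie algebra of all matrices $X$ with $e^{tX}\in G$ for every $t\in\mathbb R$. Then every element of $\mathcal U_{|\psi\rangle}$ is a finite product of elements of $\bigcup_k\mathcal U_{\mathcal N_k,|\psi\rangle}$ if and only if $$\langle\mathfrak u_{\mathcal N_k,|\psi\rangle}\rangle_k=\mathfrak u_{|\psi\rangle},$$ where $\langle\,\cdot\,\rangle_k$ denotes the smallest real Lie algebra of matrices (with the commutator bracket) that contains all the $\mathfrak u_{\mathcal N_k,|\psi\rangle}$, $k=1,\dots,K$. -/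

import Mathlib

open scoped Kronecker

/-! Square matrices form a Lie ring under the commutator bracket. -/

attribute [local instance 100] LieRing.ofAssociativeRing

namespace QuasiLocal

/-- Labels of the product basis of `⨂ i, ℂ^(d i)`. The multipartite Hilbert space is
`EuclideanSpace ℂ (Config d)` and its operators are matrices indexed by `Config d`. -/
abbrev Config {N : ℕ} (d : Fin N → ℕ) : Type := (i : Fin N) → Fin (d i)

/-- Labels of the product basis of `⨂ i ∈ S, ℂ^(d i)`. -/
abbrev ConfigOn {N : ℕ} (d : Fin N → ℕ) (S : Finset (Fin N)) : Type :=
  (i : {i : Fin N // i ∈ S}) → Fin (d i)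

/-- Labels of the product basis of `⨂ i ∉ S, ℂ^(d i)`. -/
abbrev ConfigOff {N : ℕ} (d : Fin N → ℕ) (S : Finset (Fin N)) : Type :=
  (i : {i : Fin N // ¬ i ∈ S}) → Fin (d i)

/-- The identification of the basis of `ℋ` with that of `ℋ_S ⊗ ℋ_{Sᶜ}`, by restriction. -/
def splitConfig {N : ℕ} (d : Fin N → ℕ) (S : Finset (Fin N)) :
    Config d ≃ ConfigOn d S × ConfigOff d S :=
  Equiv.piEquivPiSubtypeProd (fun i => i ∈ S) (fun i => Fin (d i))

/-- The operator `V ⊗ 𝟙` on `ℋ ≃ ℋ_S ⊗ ℋ_{Sᶜ}`. -/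
def localOp {N : ℕ} (d : Fin N → ℕ) (S : Finset (Fin N))
    (V : Matrix (ConfigOn d S) (ConfigOn d S) ℂ) : Matrix (Config d) (Config d) ℂ :=
  (V ⊗ₖ (1 : Matrix (ConfigOff d S) (ConfigOff d S) ℂ)).submatrix
    (splitConfig d S) (splitConfig d S)

theorem localOp_one {N : ℕ} (d : Fin N → ℕ) (S : Finset (Fin N)) :
    localOp d S 1 = 1 := by
  simp [localOp]

theorem localOp_mul {N : ℕ} (d : Fin N → ℕ) (S : Finset (Fin N))
    (V W : Matrix (ConfigOn d S) (ConfigOn d S) ℂ) :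
    localOp d S (V * W) = localOp d S V * localOp d S W := by
  simp [localOp, Matrix.submatrix_mul_equiv, ← Matrix.mul_kronecker_mul]

theorem localOp_star {N : ℕ} (d : Fin N → ℕ) (S : Finset (Fin N))
    (V : Matrix (ConfigOn d S) (ConfigOn d S) ℂ) :
    localOp d S (star V) = star (localOp d S V) := by
  simp [localOp, Matrix.star_eq_conjTranspose, Matrix.conjTranspose_kronecker]

/-- The homomorphism `V ↦ V ⊗ 𝟙` from `𝒰(ℋ_S)` to `𝒰(ℋ)`. -/
def localUnitaryHom {N : ℕ} (d : Fin N → ℕ) (S : Finset (Fin N)) :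
    Matrix.unitaryGroup (ConfigOn d S) ℂ →* Matrix.unitaryGroup (Config d) ℂ where
  toFun V := ⟨localOp d S V, by
    rw [Matrix.mem_unitaryGroup_iff, ← localOp_star, ← localOp_mul,
      Matrix.mem_unitaryGroup_iff.mp V.2, localOp_one]⟩
  map_one' := Subtype.ext (localOp_one d S)
  map_mul' V W := Subtype.ext (localOp_mul d S V W)

/-- The rank-one operator `|ψ⟩⟨ψ|`. -/
def ketbra {n : Type*} (ψ : EuclideanSpace ℂ n) : Matrix n n ℂ :=
  Matrix.vecMulVec (fun x => ψ x) (fun x => star (ψ x))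

/-- The unitary stabilizer group `{U ∈ 𝒰(ℋ) | U |ψ⟩⟨ψ| U† = |ψ⟩⟨ψ|}`. -/
def unitaryStabilizer {n : Type*} [Fintype n] [DecidableEq n] (ψ : EuclideanSpace ℂ n) :
    Subgroup (Matrix.unitaryGroup n ℂ) where
  carrier := {U | (U : Matrix n n ℂ) * ketbra ψ * star (U : Matrix n n ℂ) = ketbra ψ}
  one_mem' := by simp
  mul_mem' := by
    intro U V hU hV
    simp only [Set.mem_ofPred_eq] at hU hV ⊢
    calc ((U * V : Matrix.unitaryGroup n ℂ) : Matrix n n ℂ) * ketbra ψ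
          * star ((U * V : Matrix.unitaryGroup n ℂ) : Matrix n n ℂ)
        = (U : Matrix n n ℂ) * ((V : Matrix n n ℂ) * ketbra ψ * star (V : Matrix n n ℂ))
          * star (U : Matrix n n ℂ) := by
          simp only [Submonoid.coe_mul, star_mul, mul_assoc]
      _ = ketbra ψ := by rw [hV, hU]
  inv_mem' := by
    intro U hU
    simp only [Set.mem_ofPred_eq] at hU ⊢
    have h : star (U : Matrix n n ℂ) * (U : Matrix n n ℂ) = 1 :=
      Matrix.mem_unitaryGroup_iff'.mp U.2
    have hi : ((U⁻¹ : Matrix.unitaryGroup n ℂ) : Matrix n n ℂ) = star (U : Matrix n n ℂ) := rfl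
    rw [hi, star_star]
    calc star (U : Matrix n n ℂ) * ketbra ψ * (U : Matrix n n ℂ)
        = star (U : Matrix n n ℂ) *
          ((U : Matrix n n ℂ) * ketbra ψ * star (U : Matrix n n ℂ)) * (U : Matrix n n ℂ) := by
          rw [hU]
      _ = (star (U : Matrix n n ℂ) * (U : Matrix n n ℂ)) * ketbra ψ
          * (star (U : Matrix n n ℂ) * (U : Matrix n n ℂ)) := by simp only [mul_assoc]
      _ = ketbra ψ := by rw [h, one_mul, mul_one]

/-- The neighborhood unitary stabilizer group
`{U ∈ 𝒰(ℋ_S) ⊗ 𝟙 | U |ψ⟩⟨ψ| U† = |ψ⟩⟨ψ|}`. -/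
def nbhdUnitaryStabilizer {N : ℕ} (d : Fin N → ℕ) (S : Finset (Fin N))
    (ψ : EuclideanSpace ℂ (Config d)) : Subgroup (Matrix.unitaryGroup (Config d) ℂ) :=
  (localUnitaryHom d S).range ⊓ unitaryStabilizer ψ

/-- The Lie algebra of a group `G` of unitary matrices: the set of all matrices `X` such that
`exp (t X) ∈ G` for every real `t`. -/
def lieAlgebraOf {n : Type*} [Fintype n] [DecidableEq n]
    (G : Subgroup (Matrix.unitaryGroup n ℂ)) : Set (Matrix n n ℂ) :=
  {X | ∀ t : ℝ, ∃ U ∈ G, (U : Matrix n n ℂ) = NormedSpace.exp (t • X)}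

end QuasiLocal

/-! With `P = |ψ⟩⟨ψ|`, the stabilizer is the group of unitaries commuting with `P`. Its Lie algebra
`𝔤` is `skewCommutant P`, and principal logarithms show that every element is an exponential from
`𝔤`.

Lie algebra to group (`mem_of_lieSpan_eq`): let `H` be the generated group. The span of the
`H`-conjugates of the local generators is stable under bracketing with them, hence is `𝔤`. A basis
of such conjugates has its one-parameter groups in `H`, and the product of these has surjective
differential onto `𝔤`. So `H` contains `exp (s X)` for each `X` in `𝔤` and small `s`, and powers
give `exp X`.

Group to Lie algebra (`skewCommutant_le_of_forall_eq_prod`): local unitaries are exponentials from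
the generated algebra `L`, so `L` is stable under conjugation by the whole stabilizer and is an
ideal of `𝔤`. Some `Z` in `𝔤` orthogonal to `L` for `Re tr (X Y)` is then central, so `Z = a P + b
1`. Comparing determinants and eigenvalues on `P` in `exp (s Z) = ∏ exp Xᵢ` confines `s` to a
countable set unless `Z = 0`. -/

namespace QuasiLocal

/-! ### Matrix exponentials, invariant subspaces and determinants. -/

section Exponential

open NormedSpace Filter Topology
open scoped Matrix.Norms.L2Operator

variable {n : Type*} [Fintype n] [DecidableEq n]

theorem hasDerivAt_exp_smul_zero (X : Matrix n n ℂ) :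
    HasDerivAt (fun t : ℝ => exp (t • X)) X 0 := by
  simpa using hasDerivAt_exp_smul_const (𝕂 := ℝ) X 0

theorem exp_mul_exp_neg (X : Matrix n n ℂ) : exp X * exp (-X) = 1 := by
  rw [← Matrix.exp_add_of_commute X (-X) (Commute.refl X).neg_right]
  simp

theorem commute_of_forall_commute_exp {X Y : Matrix n n ℂ}
    (h : ∀ t : ℝ, Commute (exp (t • X)) Y) : Commute X Y := by
  have h₁ := (hasDerivAt_exp_smul_zero X).mul_const Y
  have h₂ := (hasDerivAt_exp_smul_zero X).const_mul Y
  have e : (fun t : ℝ => exp (t • X) * Y) = fun t => Y * exp (t • X) := funext fun t => h t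
  rw [e] at h₁
  exact h₁.unique h₂

theorem star_eq_neg_of_forall_exp_mem_unitary {X : Matrix n n ℂ}
    (h : ∀ t : ℝ, exp (t • X) ∈ Matrix.unitaryGroup n ℂ) : star X = -X := by
  have h₁ := (hasDerivAt_exp_smul_zero (star X)).mul (hasDerivAt_exp_smul_zero X)
  have e : (fun t : ℝ => exp (t • star X) * exp (t • X)) = fun _ => 1 := by
    funext t
    have := Matrix.mem_unitaryGroup_iff'.mp (h t)
    rwa [star_exp, star_smul, star_trivial] at this
  have h₂ : HasDerivAt (fun t : ℝ => exp (t • star X) * exp (t • X)) 0 0 := by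
    rw [e]; exact hasDerivAt_const _ _
  have := h₁.unique h₂
  simp only [zero_smul, exp_zero, mul_one, one_mul] at this
  exact eq_neg_of_add_eq_zero_left this

theorem exp_mem_unitaryGroup {X : Matrix n n ℂ} (h : star X = -X) :
    exp X ∈ Matrix.unitaryGroup n ℂ := by
  rw [Matrix.mem_unitaryGroup_iff, star_exp, h, exp_mul_exp_neg]

theorem hasSum_exp_apply {T : Matrix n n ℂ →L[ℝ] Matrix n n ℂ} {Y : Matrix n n ℂ} :
    HasSum (fun k : ℕ => ((k.factorial : ℝ)⁻¹) • (T ^ k) Y) (exp T Y) :=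
  (exp_series_hasSum_exp' (𝕂 := ℝ) T).mapL
    (ContinuousLinearMap.apply ℝ (Matrix n n ℂ) Y)

theorem exp_mulLeft_apply (X Y : Matrix n n ℂ) :
    exp (ContinuousLinearMap.mul ℝ (Matrix n n ℂ) X) Y = exp X * Y := by
  have hp : ∀ k : ℕ, (ContinuousLinearMap.mul ℝ (Matrix n n ℂ) X ^ k) Y = X ^ k * Y := by
    intro k
    induction k with
    | zero => simp
    | succ k ih => rw [pow_succ', pow_succ', mul_assoc, ← ih]; rfl
  refine hasSum_exp_apply.unique ?_
  simp only [hp, ← Matrix.smul_mul]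
  exact (exp_series_hasSum_exp' (𝕂 := ℝ) X).mul_right Y

theorem exp_mulRight_apply (X Y : Matrix n n ℂ) :
    exp ((ContinuousLinearMap.mul ℝ (Matrix n n ℂ)).flip X) Y = Y * exp X := by
  have hp : ∀ k : ℕ, ((ContinuousLinearMap.mul ℝ (Matrix n n ℂ)).flip X ^ k) Y = Y * X ^ k := by
    intro k
    induction k with
    | zero => simp
    | succ k ih => rw [pow_succ', pow_succ, ← mul_assoc, ← ih]; rfl
  refine hasSum_exp_apply.unique ?_
  simp only [hp, ← Matrix.mul_smul]
  exact (exp_series_hasSum_exp' (𝕂 := ℝ) X).mul_left Y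

/-- `exp X * Y * exp (-X)` stays in every subspace that is invariant under `[X, ·]`. -/
theorem exp_mul_mul_exp_neg_mem {W : Submodule ℝ (Matrix n n ℂ)} {X Y : Matrix n n ℂ}
    (h : ∀ Z ∈ W, X * Z - Z * X ∈ W) (hY : Y ∈ W) : exp X * Y * exp (-X) ∈ W := by
  -- `ad X` is the sum of the commuting maps `l` and `r`, so conjugation by `exp X` is `exp (ad X)`,
  -- a limit of sums that stay in the closed subspace `W`.
  let l := ContinuousLinearMap.mul ℝ (Matrix n n ℂ) X
  let r := (ContinuousLinearMap.mul ℝ (Matrix n n ℂ)).flip (-X)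
  have hc : Commute l r := by
    ext1 Z
    simp [l, r, mul_assoc]
  let _ : NormedAlgebra ℚ (Matrix n n ℂ →L[ℝ] Matrix n n ℂ) := .restrictScalars ℚ ℝ _
  have he : exp (l + r) Y = exp X * Y * exp (-X) := by
    rw [add_comm, exp_add_of_commute hc.symm]
    change exp r (exp l Y) = _
    rw [exp_mulLeft_apply, exp_mulRight_apply]
  rw [← he]
  have hp : ∀ k : ℕ, ((l + r) ^ k) Y ∈ W := by
    intro k
    induction k with
    | zero => simpa using hY
    | succ k ih =>
      have := h _ ih
      rw [pow_succ']
      simpa [l, r, sub_eq_add_neg] using this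
  exact (Submodule.closed_of_finiteDimensional W).mem_of_tendsto hasSum_exp_apply
    (Eventually.of_forall fun s => W.sum_mem fun k _ => W.smul_mem _ (hp k))

/-- The commutator is the derivative at `0` of the conjugates, and `W` is closed. -/
theorem commutator_mem_of_forall_exp {W : Submodule ℝ (Matrix n n ℂ)} {X Y : Matrix n n ℂ}
    (h : ∀ t : ℝ, exp (t • X) * Y * exp (-(t • X)) ∈ W) : X * Y - Y * X ∈ W := by
  have h₁ : HasDerivAt (fun t : ℝ => exp (t • X) * Y * exp (t • -X)) (X * Y - Y * X) 0 := by
    have := ((hasDerivAt_exp_smul_zero X).mul_const Y).mul (hasDerivAt_exp_smul_zero (-X))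
    exact this.congr_deriv (by simp [sub_eq_add_neg])
  rw [hasDerivAt_iff_tendsto_slope] at h₁
  refine (Submodule.closed_of_finiteDimensional W).mem_of_tendsto h₁
    (Eventually.of_forall fun t => ?_)
  refine W.smul_mem _ (W.sub_mem ?_ ?_)
  · simpa using h t
  · simpa using h 0

/-- `i X` is Hermitian, so `X` is unitarily diagonalizable. -/
theorem det_exp_of_star_eq_neg {X : Matrix n n ℂ} (h : star X = -X) :
    (exp X).det = Complex.exp X.trace := by
  have hH : (Complex.I • X).IsHermitian := by
    rw [Matrix.IsHermitian, ← Matrix.star_eq_conjTranspose, star_smul, h]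
    simp
  obtain ⟨U, D, hX⟩ : ∃ (U : Matrix.unitaryGroup n ℂ) (D : n → ℂ),
      X = (U : Matrix n n ℂ) * Matrix.diagonal D * star (U : Matrix n n ℂ) := by
    refine ⟨hH.eigenvectorUnitary, (-Complex.I) • (RCLike.ofReal ∘ hH.eigenvalues), ?_⟩
    have h₁ := hH.spectral_theorem
    have h₂ : X = (-Complex.I) • (Complex.I • X) := by simp [smul_smul]
    rw [Unitary.conjStarAlgAut_apply] at h₁
    rw [Matrix.diagonal_smul, Matrix.mul_smul, Matrix.smul_mul, ← h₁, ← h₂]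
  have hu : star (U : Matrix n n ℂ) * (U : Matrix n n ℂ) = 1 := Matrix.mem_unitaryGroup_iff'.mp U.2
  have hu' : (U : Matrix n n ℂ) * star (U : Matrix n n ℂ) = 1 := Matrix.mem_unitaryGroup_iff.mp U.2
  have key := Matrix.exp_units_conj ⟨(U : Matrix n n ℂ), star (U : Matrix n n ℂ), hu', hu⟩
    (Matrix.diagonal D)
  simp only [Units.val_mk, Units.inv_mk] at key
  rw [hX, key, Matrix.exp_diagonal, Matrix.det_mul_right_comm, hu', one_mul, Matrix.det_diagonal,
    Matrix.trace_mul_cycle, hu, one_mul, Matrix.trace_diagonal, Complex.exp_sum]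
  simp [Pi.coe_exp, Complex.exp_eq_exp_ℂ]

theorem mul_exp_of_mul_eq_smul {P X : Matrix n n ℂ} {c : ℂ} (h : P * X = c • P) :
    P * exp X = Complex.exp c • P := by
  have hp : ∀ k : ℕ, P * X ^ k = c ^ k • P := by
    intro k
    induction k with
    | zero => simp
    | succ k ih => rw [pow_succ, ← mul_assoc, ih, Matrix.smul_mul, h, smul_smul, pow_succ]
  have h₁ := (exp_series_hasSum_exp' (𝕂 := ℂ) X).mul_left P
  have h₂ := (exp_series_hasSum_exp' (𝕂 := ℂ) c).smul_const P
  rw [Complex.exp_eq_exp_ℂ]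
  refine h₁.unique ?_
  simpa only [Matrix.mul_smul, hp, smul_smul, smul_eq_mul] using h₂

end Exponential

/-! ### Lie algebra of the stabilizer, and logarithms of unitaries. -/

section Stabilizer

open NormedSpace Filter Topology
open scoped Matrix.Norms.L2Operator

variable {n : Type*} [Fintype n] [DecidableEq n]

/-- The skew-Hermitian matrices commuting with `P`. -/
def skewCommutant (P : Matrix n n ℂ) : LieSubalgebra ℝ (Matrix n n ℂ) where
  carrier := {X | star X = -X ∧ Commute X P}
  add_mem' := by
    rintro X Y ⟨hX, hX'⟩ ⟨hY, hY'⟩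
    exact ⟨by rw [star_add, hX, hY]; abel, hX'.add_left hY'⟩
  zero_mem' := ⟨by simp, Commute.zero_left P⟩
  smul_mem' := by
    rintro t X ⟨hX, hX'⟩
    exact ⟨by rw [star_smul, hX, star_trivial, smul_neg], hX'.smul_left t⟩
  lie_mem' := by
    rintro X Y ⟨hX, hX'⟩ ⟨hY, hY'⟩
    refine ⟨?_, ?_⟩
    · simp only [LieRing.of_associative_ring_bracket, star_sub, star_mul, hX, hY]
      noncomm_ring
    · exact (hX'.mul_left hY').sub_left (hY'.mul_left hX')

theorem mem_unitaryStabilizer_iff {ψ : EuclideanSpace ℂ n} {U : Matrix.unitaryGroup n ℂ} :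
    U ∈ unitaryStabilizer ψ ↔ Commute (U : Matrix n n ℂ) (ketbra ψ) := by
  have h₁ : star (U : Matrix n n ℂ) * (U : Matrix n n ℂ) = 1 := Matrix.mem_unitaryGroup_iff'.mp U.2
  have h₂ : (U : Matrix n n ℂ) * star (U : Matrix n n ℂ) = 1 := Matrix.mem_unitaryGroup_iff.mp U.2
  change (U : Matrix n n ℂ) * ketbra ψ * star (U : Matrix n n ℂ) = ketbra ψ ↔
    (U : Matrix n n ℂ) * ketbra ψ = ketbra ψ * U
  constructor <;> intro h
  · calc (U : Matrix n n ℂ) * ketbra ψ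
        = U * ketbra ψ * star (U : Matrix n n ℂ) * U := by rw [mul_assoc _ _ (U : Matrix n n ℂ), h₁,
          mul_one]
      _ = ketbra ψ * U := by rw [h]
  · rw [h, mul_assoc, h₂, mul_one]

theorem exp_smul_mem_unitaryGroup {P X : Matrix n n ℂ} (h : X ∈ skewCommutant P) (t : ℝ) :
    exp (t • X) ∈ Matrix.unitaryGroup n ℂ :=
  exp_mem_unitaryGroup (LieSubalgebra.smul_mem _ t h).1

theorem lieAlgebraOf_unitaryStabilizer (ψ : EuclideanSpace ℂ n) :
    lieAlgebraOf (unitaryStabilizer ψ) = skewCommutant (ketbra ψ) := by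
  ext X
  refine ⟨fun h => ⟨star_eq_neg_of_forall_exp_mem_unitary fun t => ?_,
    commute_of_forall_commute_exp fun t => ?_⟩, fun h t => ?_⟩
  · obtain ⟨U, -, hU⟩ := h t
    exact hU ▸ U.2
  · obtain ⟨U, hU, hU'⟩ := h t
    exact hU' ▸ mem_unitaryStabilizer_iff.mp hU
  · exact ⟨⟨_, exp_smul_mem_unitaryGroup h t⟩,
      mem_unitaryStabilizer_iff.mpr (h.2.smul_left t).exp_left, rfl⟩

theorem lieAlgebraOf_mono {G H : Subgroup (Matrix.unitaryGroup n ℂ)} (h : G ≤ H) :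
    lieAlgebraOf G ⊆ lieAlgebraOf H := fun _ hX t =>
  let ⟨U, hU, hU'⟩ := hX t
  ⟨U, h hU, hU'⟩

/-- The principal logarithm of a unitary matrix. -/
noncomputable def unitaryLog (U : Matrix n n ℂ) : Matrix n n ℂ := cfc Complex.log U

/-- Finiteness of the spectrum makes the branch cut of `Complex.log` harmless, even at the
eigenvalue `-1`. -/
theorem continuousOn_spectrum (f : ℂ → ℂ) (U : Matrix n n ℂ) : ContinuousOn f (spectrum ℂ U) :=
  (Matrix.finite_spectrum U).continuousOn f

theorem norm_eq_one_of_mem_spectrum {U : Matrix n n ℂ} (hU : U ∈ Matrix.unitaryGroup n ℂ) {z : ℂ}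
    (hz : z ∈ spectrum ℂ U) : ‖z‖ = 1 := by
  simpa using spectrum.subset_circle_of_unitary hU hz

theorem star_unitaryLog {U : Matrix n n ℂ} (hU : U ∈ Matrix.unitaryGroup n ℂ) :
    star (unitaryLog U) = -unitaryLog U := by
  rw [unitaryLog, ← cfc_star, ← cfc_neg]
  refine cfc_congr fun z hz => ?_
  have := norm_eq_one_of_mem_spectrum hU hz
  apply Complex.ext <;> simp [Complex.log_re, this]

theorem exp_unitaryLog {U : Matrix n n ℂ} (hU : U ∈ Matrix.unitaryGroup n ℂ) :
    exp (unitaryLog U) = U := by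
  have hn : IsStarNormal U := ⟨by
    rw [Commute, SemiconjBy, Matrix.mem_unitaryGroup_iff.mp hU, Matrix.mem_unitaryGroup_iff'.mp hU]⟩
  have hl : IsStarNormal (unitaryLog U) := by
    constructor
    rw [star_unitaryLog hU]
    exact (Commute.refl _).neg_left
  rw [← CFC.complex_exp_eq_normedSpace_exp, unitaryLog,
    ← cfc_comp' Complex.exp Complex.log U (by fun_prop) (continuousOn_spectrum _ _)]
  conv_rhs => rw [← cfc_id ℂ U]
  refine cfc_congr fun z hz => Complex.exp_log ?_
  rintro rfl
  simpa using norm_eq_one_of_mem_spectrum hU hz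

theorem commute_unitaryLog {U P : Matrix n n ℂ} (hU : U ∈ Matrix.unitaryGroup n ℂ)
    (h : Commute U P) : Commute (unitaryLog U) P := by
  refine Commute.cfc h ?_ _
  have h₁ := Matrix.mem_unitaryGroup_iff'.mp hU
  have h₂ := Matrix.mem_unitaryGroup_iff.mp hU
  calc star U * P = star U * (P * U) * star U := by simp only [mul_assoc, h₂, mul_one]
    _ = P * star U := by rw [← h.eq, ← mul_assoc, h₁, one_mul]

theorem unitaryLog_mem_skewCommutant {U P : Matrix n n ℂ} (hU : U ∈ Matrix.unitaryGroup n ℂ)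
    (h : Commute U P) : unitaryLog U ∈ skewCommutant P :=
  ⟨star_unitaryLog hU, commute_unitaryLog hU h⟩

variable {N : ℕ} (d : Fin N → ℕ) (S : Finset (Fin N))

/-- `V ↦ V ⊗ 𝟙` as a homomorphism of star algebras. -/
def localOpHom : Matrix (ConfigOn d S) (ConfigOn d S) ℂ →⋆ₐ[ℂ] Matrix (Config d) (Config d) ℂ where
  toFun := localOp d S
  map_one' := localOp_one d S
  map_mul' := localOp_mul d S
  map_zero' := by simp [localOp]
  map_add' V W := by rw [localOp, Matrix.add_kronecker]; rfl
  commutes' c := by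
    rw [Algebra.algebraMap_eq_smul_one, Algebra.algebraMap_eq_smul_one, ← localOp_one d S]
    rw [localOp, Matrix.smul_kronecker]
    rfl
  map_star' := localOp_star d S

theorem continuous_localOpHom : Continuous (localOpHom d S) :=
  LinearMap.continuous_of_finiteDimensional (localOpHom d S).toAlgHom.toLinearMap

theorem localOp_exp (X : Matrix (ConfigOn d S) (ConfigOn d S) ℂ) :
    localOp d S (exp X) = exp (localOp d S X) := by
  let _ : NormedAlgebra ℚ (Matrix (ConfigOn d S) (ConfigOn d S) ℂ) := .restrictScalars ℚ ℂ _
  exact map_exp (localOpHom d S) (continuous_localOpHom d S) X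

theorem localOp_unitaryLog {V : Matrix (ConfigOn d S) (ConfigOn d S) ℂ}
    (hV : V ∈ Matrix.unitaryGroup (ConfigOn d S) ℂ) :
    localOp d S (unitaryLog V) = unitaryLog (localOp d S V) := by
  have hn : IsStarNormal V := ⟨by
    rw [Commute, SemiconjBy, Matrix.mem_unitaryGroup_iff.mp hV, Matrix.mem_unitaryGroup_iff'.mp hV]⟩
  exact (localOpHom d S).map_cfc Complex.log V (continuousOn_spectrum _ _)
    (continuous_localOpHom d S) hn (hn.map _)

/-- Functional calculus commutes with `V ↦ V ⊗ 𝟙`, so the logarithm of a local unitary is local; it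
also commutes with whatever the unitary commutes with. -/
theorem unitaryLog_mem_lieAlgebraOf_nbhd {ψ : EuclideanSpace ℂ (Config d)}
    {U : Matrix.unitaryGroup (Config d) ℂ} (hU : U ∈ nbhdUnitaryStabilizer d S ψ) :
    unitaryLog (U : Matrix (Config d) (Config d) ℂ) ∈
      lieAlgebraOf (nbhdUnitaryStabilizer d S ψ) := by
  obtain ⟨⟨V, rfl⟩, hU⟩ := hU
  have hc := unitaryLog_mem_skewCommutant (localUnitaryHom d S V).2
    (mem_unitaryStabilizer_iff.mp hU)
  intro t
  have he : localOp d S (exp (t • unitaryLog (V : Matrix (ConfigOn d S) (ConfigOn d S) ℂ))) =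
      exp (t • unitaryLog (localUnitaryHom d S V : Matrix (Config d) (Config d) ℂ)) := by
    rw [localOp_exp]
    congr 1
    change localOpHom d S _ = _
    rw [← Complex.coe_smul, map_smul]
    exact congrArg _ (localOp_unitaryLog d S V.2)
  refine ⟨localUnitaryHom d S ⟨_, exp_mem_unitaryGroup 
      (X := t • unitaryLog (V : Matrix (ConfigOn d S) (ConfigOn d S) ℂ)) ?_⟩,
    ⟨⟨_, rfl⟩, mem_unitaryStabilizer_iff.mpr ?_⟩, he⟩
  · rw [star_smul, star_unitaryLog V.2, star_trivial, smul_neg]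
  · change Commute (localOp d S _) _
    rw [he]
    exact (hc.2.smul_left t).exp_left

end Stabilizer

/-! ### From the Lie algebra to the group. -/

section Generation

open NormedSpace Filter Topology
open scoped Matrix.Norms.L2Operator

variable {n : Type*} [Fintype n] [DecidableEq n]

/-- A subspace that contains a set and is invariant under bracketing with its elements contains the
Lie algebra that the set generates. -/
theorem lieSpan_subset_of_lie_mem {L : Type*} [LieRing L] [LieAlgebra ℝ L] {s : Set L}
    {W : Submodule ℝ L} (hs : s ⊆ W) (h : ∀ X ∈ s, ∀ Y ∈ W, ⁅X, Y⁆ ∈ W) {X : L}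
    (hX : X ∈ LieSubalgebra.lieSpan ℝ L s) : X ∈ W := by
  -- The strengthened claim is closed under brackets, by the Jacobi identity.
  suffices X ∈ W ∧ ∀ Y ∈ W, ⁅X, Y⁆ ∈ W from this.1
  induction hX using LieSubalgebra.lieSpan_induction with
  | mem x hx => exact ⟨hs hx, h x hx⟩
  | zero => exact ⟨W.zero_mem, fun Y _ => by simp⟩
  | add x y _ _ hx hy =>
    exact ⟨W.add_mem hx.1 hy.1, fun Y hY => by
      rw [add_lie]; exact W.add_mem (hx.2 Y hY) (hy.2 Y hY)⟩
  | smul a x _ hx =>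
    exact ⟨W.smul_mem a hx.1, fun Y hY => by rw [smul_lie]; exact W.smul_mem a (hx.2 Y hY)⟩
  | lie x y _ _ hx hy =>
    exact ⟨hx.2 y hy.1, fun Y hY => by
      rw [lie_lie]; exact W.sub_mem (hx.2 _ (hy.2 Y hY)) (hy.2 _ (hx.2 Y hY))⟩

/-- Near the identity, a unitary matrix is determined by its skew-Hermitian part. -/
theorem eq_of_sub_star_eq_sub_star {U V : Matrix n n ℂ} (hU : U ∈ Matrix.unitaryGroup n ℂ)
    (hV : V ∈ Matrix.unitaryGroup n ℂ) (h : U - star U = V - star V)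
    (hU' : ‖2 - (U + star U)‖ < 2) (hV' : ‖2 - (V + star V)‖ < 2) : U = V := by
  have sq : ∀ X : Matrix n n ℂ, X ∈ Matrix.unitaryGroup n ℂ →
      (X + star X) * (X + star X) = (X - star X) * (X - star X) + 4 := by
    intro X hX
    have h₁ := Matrix.mem_unitaryGroup_iff'.mp hX
    have h₂ := Matrix.mem_unitaryGroup_iff.mp hX
    simp only [add_mul, mul_add, sub_mul, mul_sub, h₁, h₂]
    have : (4 : Matrix n n ℂ) = 1 + 1 + 1 + 1 := by norm_num
    rw [this]
    abel
  have hsq : (U + star U) * (U + star U) = (V + star V) * (V + star V) := by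
    rw [sq U hU, sq V hV, h]
  set a := U + star U
  set b := V + star V
  -- Since `a² = b²`, this identity bounds `4 ‖a - b‖` by a factor below `4` times `‖a - b‖` unless
  -- `a = b`; no commutation of `a` and `b` is needed.
  have hD : (4 : ℝ) • (a - b) = (2 - a) * (a - b) + (a - b) * (2 - b) := by
    have e : (2 - a) * (a - b) + (a - b) * (2 - b) = 4 * (a - b) - (a * a - b * b) := by
      noncomm_ring
    rw [e, hsq, sub_self, sub_zero, ofNat_smul_eq_nsmul ℝ 4, nsmul_eq_mul]
    norm_num
  have hab : a - b = 0 := by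
    by_contra hne
    have hpos : 0 < ‖a - b‖ := norm_pos_iff.mpr hne
    have h₁ : 4 * ‖a - b‖ ≤ ‖2 - a‖ * ‖a - b‖ + ‖a - b‖ * ‖2 - b‖ := by
      calc 4 * ‖a - b‖ = ‖(4 : ℝ) • (a - b)‖ := by rw [norm_smul]; norm_num
        _ ≤ _ := by
          rw [hD]
          exact (norm_add_le _ _).trans (add_le_add (norm_mul_le _ _) (norm_mul_le _ _))
    nlinarith
  have h2 : (2 : ℂ) • U = (2 : ℂ) • V := by
    have e₁ : (2 : ℂ) • U = a + (U - star U) := by rw [two_smul]; simp only [a]; abel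
    have e₂ : (2 : ℂ) • V = b + (V - star V) := by rw [two_smul]; simp only [b]; abel
    rw [e₁, e₂, h, sub_eq_zero.mp hab]
  exact smul_right_injective _ (two_ne_zero' ℂ) h2

/-- The derivative at the origin of a product of one-parameter groups. -/
theorem hasStrictFDerivAt_prod_exp {ι : Type*} [Fintype ι] (x : ι → Matrix n n ℂ) :
    HasStrictFDerivAt
      (fun t : ι → ℝ => ((Finset.univ : Finset ι).toList.map fun i => exp (t i • x i)).prod)
      (∑ i, (ContinuousLinearMap.proj (R := ℝ) (φ := fun _ : ι => ℝ) i).smulRight (x i)) 0 := by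
  have h : ∀ i : ι, HasStrictFDerivAt (fun t : ι → ℝ => exp (t i • x i))
      ((ContinuousLinearMap.proj (R := ℝ) (φ := fun _ : ι => ℝ) i).smulRight (x i)) 0 := by
    intro i
    have h₁ := ((ContinuousLinearMap.proj (R := ℝ) (φ := fun _ : ι => ℝ) i).smulRight
      (x i)).hasStrictFDerivAt (x := 0)
    have h₂ : HasStrictFDerivAt (exp : Matrix n n ℂ → Matrix n n ℂ) (1 : _ →L[ℝ] _)
        (((ContinuousLinearMap.proj (R := ℝ) (φ := fun _ : ι => ℝ) i).smulRight (x i)) 0) := by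
      rw [map_zero]
      exact hasStrictFDerivAt_exp_zero
    exact h₂.comp 0 h₁
  refine (HasStrictFDerivAt.list_prod' (l := Finset.univ.toList) fun i _ => h i).congr_fderiv ?_
  simp only [Pi.zero_apply, zero_smul, exp_zero, List.map_const', List.prod_replicate, one_pow,
    MulOpposite.op_one, one_smul]
  exact (Fin.sum_univ_fun_getElem _ _).trans (Finset.sum_map_toList Finset.univ
    fun i => (ContinuousLinearMap.proj (R := ℝ) (φ := fun _ : ι => ℝ) i).smulRight (x i))

/-- If the one-parameter groups of the `x i` lie in `H` and the `x i` span the Lie algebra of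
skew-Hermitian matrices commuting with `P`, then `H` contains every exponential near `1`. -/
theorem eventually_exp_smul_mem {P : Matrix n n ℂ} {H : Submonoid (Matrix n n ℂ)}
    (hH : ∀ U ∈ H, U ∈ Matrix.unitaryGroup n ℂ ∧ Commute U P)
    {ι : Type*} [Fintype ι] {x : ι → Matrix n n ℂ} (hx : ∀ i, ∀ t : ℝ, exp (t • x i) ∈ H)
    (hspan : Submodule.span ℝ (Set.range x) = (skewCommutant P).toSubmodule)
    {X : Matrix n n ℂ} (hX : X ∈ skewCommutant P) : ∀ᶠ s : ℝ in 𝓝 0, exp (s • X) ∈ H := by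
  set W := (skewCommutant P).toSubmodule
  obtain ⟨p, hp⟩ := W.subtype.exists_leftInverse_of_injective W.ker_subtype
  have hpW : ∀ Y (hY : Y ∈ W), p Y = ⟨Y, hY⟩ := fun Y hY => LinearMap.congr_fun hp ⟨Y, hY⟩
  -- `q` serves as a chart near `1`: it takes values in the linear space `W`, and
  -- `eq_of_sub_star_eq_sub_star` makes it injective on the relevant unitaries.
  let q : Matrix n n ℂ →L[ℝ] W := (LinearMap.toContinuousLinearMap p).comp
    (ContinuousLinearMap.id ℝ _ - (starL' ℝ : Matrix n n ℂ ≃L[ℝ] Matrix n n ℂ).toContinuousLinearMap)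
  have hq : ∀ Y, q Y = p (Y - star Y) := fun Y => rfl
  have hskew : ∀ U : Matrix n n ℂ, U ∈ Matrix.unitaryGroup n ℂ → Commute U P →
      U - star U ∈ W := by
    intro U hU hc
    have h₁ := Matrix.mem_unitaryGroup_iff'.mp hU
    have h₂ := Matrix.mem_unitaryGroup_iff.mp hU
    refine ⟨by rw [star_sub, star_star, neg_sub], hc.sub_left ?_⟩
    calc star U * P = star U * (P * U) * star U := by simp only [mul_assoc, h₂, mul_one]
      _ = P * star U := by rw [← hc.eq, ← mul_assoc, h₁, one_mul]
  set φ : (ι → ℝ) → Matrix n n ℂ :=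
    fun t => ((Finset.univ : Finset ι).toList.map fun i => exp (t i • x i)).prod
  have hφ : ∀ t, φ t ∈ H := by
    intro t
    refine H.list_prod_mem fun Y hY => ?_
    obtain ⟨i, -, rfl⟩ := List.mem_map.mp hY
    exact hx i (t i)
  have hd : HasStrictFDerivAt φ _ 0 := hasStrictFDerivAt_prod_exp x
  have hφ0 : φ 0 = 1 := by simp [φ]
  have hxW : ∀ i, x i ∈ W := fun i => hspan ▸ Submodule.subset_span ⟨i, rfl⟩
  have hqx : ∀ i, q (x i) = (2 : ℝ) • ⟨x i, hxW i⟩ := fun i => by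
    rw [hq, (hxW i).1, sub_neg_eq_add, map_add, hpW _ (hxW i), two_smul]
  have hsurj : (q.comp (∑ i, (ContinuousLinearMap.proj (R := ℝ) (φ := fun _ : ι => ℝ) i).smulRight
      (x i)) : (ι → ℝ) →ₗ[ℝ] W).range = ⊤ := by
    rw [LinearMap.range_eq_top]
    rintro ⟨Y, hY⟩
    rw [← hspan] at hY
    obtain ⟨c, rfl⟩ := (Submodule.mem_span_range_iff_exists_fun ℝ).mp hY
    -- `q` doubles skew-Hermitian matrices, hence the halves.
    refine ⟨fun i => c i / 2, Subtype.ext ?_⟩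
    simp [hqx, smul_smul]
  have hmap : map (q ∘ φ) (𝓝 0) = 𝓝 (q (φ 0)) := (q.hasStrictFDerivAt.comp 0 hd).map_nhds_eq_of_surj hsurj
  have hN : {t | ‖2 - (φ t + star (φ t))‖ < 2} ∈ 𝓝 (0 : ι → ℝ) := by
    have hc : ContinuousAt (fun t => ‖2 - (φ t + star (φ t))‖) 0 :=
      (continuousAt_const.sub (hd.continuousAt.add hd.continuousAt.star)).norm
    refine hc.eventually_lt continuousAt_const ?_
    norm_num [hφ0]
  have himg := image_mem_map hN (m := q ∘ φ)
  rw [hmap] at himg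
  have hcX : ContinuousAt (fun s : ℝ => exp (s • X)) 0 := (hasDerivAt_exp_smul_zero X).continuousAt
  have h₁ : ∀ᶠ s : ℝ in 𝓝 0, q (exp (s • X)) ∈ (q ∘ φ) '' {t | ‖2 - (φ t + star (φ t))‖ < 2} := by
    have : ContinuousAt (fun s : ℝ => q (exp (s • X))) 0 := q.continuous.continuousAt.comp hcX
    refine this.preimage_mem_nhds ?_
    simpa [hφ0] using himg
  have h₂ : ∀ᶠ s : ℝ in 𝓝 0, ‖2 - (exp (s • X) + star (exp (s • X)))‖ < 2 := by
    have hc : ContinuousAt (fun s : ℝ => ‖2 - (exp (s • X) + star (exp (s • X)))‖) 0 :=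
      (continuousAt_const.sub (hcX.add hcX.star)).norm
    refine hc.eventually_lt continuousAt_const ?_
    norm_num
  filter_upwards [h₁, h₂] with s hs₁ hs₂
  obtain ⟨t, ht, hts⟩ := hs₁
  have hU := exp_smul_mem_unitaryGroup hX s
  have hUc : Commute (exp (s • X)) P := (hX.2.smul_left s).exp_left
  have hV := hH _ (hφ t)
  rw [Function.comp_apply, hq, hq, hpW _ (hskew _ hU hUc), hpW _ (hskew _ hV.1 hV.2),
    Subtype.mk.injEq] at hts
  rw [← eq_of_sub_star_eq_sub_star hV.1 hU hts ht hs₂]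
  exact hφ t

/-- `exp X` is the `(m + 1)`-th power of `exp (X / (m + 1))`. -/
theorem exp_mem_of_eventually {H : Submonoid (Matrix n n ℂ)} {X : Matrix n n ℂ}
    (h : ∀ᶠ s : ℝ in 𝓝 0, exp (s • X) ∈ H) : exp X ∈ H := by
  obtain ⟨m, hm⟩ := (tendsto_one_div_add_atTop_nhds_zero_nat.eventually h).exists
  have := pow_mem hm (m + 1)
  rw [← Matrix.exp_nsmul, ← Nat.cast_smul_eq_nsmul ℝ, smul_smul] at this
  rwa [Nat.cast_succ, mul_one_div_cancel (by positivity), one_smul] at this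

/-- A group of unitaries commuting with `P` that contains the one-parameter groups of generators of
the Lie algebra of all skew-Hermitian matrices commuting with `P` contains all unitaries commuting
with `P`. -/
theorem mem_of_lieSpan_eq {P : Matrix n n ℂ} {H : Submonoid (Matrix n n ℂ)}
    (hH : ∀ U ∈ H, U ∈ Matrix.unitaryGroup n ℂ ∧ Commute U P) (hstar : ∀ U ∈ H, star U ∈ H)
    {s : Set (Matrix n n ℂ)} (hs : ∀ X ∈ s, ∀ t : ℝ, exp (t • X) ∈ H)
    (hspan : LieSubalgebra.lieSpan ℝ (Matrix n n ℂ) s = skewCommutant P)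
    {U : Matrix n n ℂ} (hU : U ∈ Matrix.unitaryGroup n ℂ) (hUP : Commute U P) : U ∈ H := by
  have hsP : s ⊆ skewCommutant P := hspan ▸ LieSubalgebra.subset_lieSpan
  set c : Set (Matrix n n ℂ) := {Y | ∃ V ∈ H, ∃ X ∈ s, Y = V * X * star V}
  set W := Submodule.span ℝ c
  have hAd : ∀ V ∈ H, ∀ Y ∈ W, V * Y * star V ∈ W := by
    intro V hV Y hY
    induction hY using Submodule.span_induction with
    | mem Y hY =>
      obtain ⟨V', hV', X, hX, rfl⟩ := hY
      exact Submodule.subset_span ⟨V * V', mul_mem hV hV', X, hX, by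
        simp only [star_mul, mul_assoc]⟩
    | zero => simp
    | add Y Z _ _ hY hZ =>
      rw [mul_add, add_mul]
      exact W.add_mem hY hZ
    | smul a Y _ hY =>
      rw [Matrix.mul_smul, Matrix.smul_mul]
      exact W.smul_mem a hY
  have hsW : s ⊆ W := fun X hX => Submodule.subset_span ⟨1, one_mem H, X, hX, by simp⟩
  have hW : W = (skewCommutant P).toSubmodule := by
    apply le_antisymm
    · refine Submodule.span_le.mpr ?_
      rintro _ ⟨V, hV, X, hX, rfl⟩
      refine ⟨?_, ((hH V hV).2.mul_left (hsP hX).2).mul_left (hH _ (hstar V hV)).2⟩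
      rw [star_mul, star_mul, star_star, (hsP hX).1]
      noncomm_ring
    · intro X hX
      refine lieSpan_subset_of_lie_mem hsW (fun X hX Y hY => ?_) (hspan ▸ hX)
      rw [LieRing.of_associative_ring_bracket]
      refine commutator_mem_of_forall_exp fun t => ?_
      have := hAd _ (hs X hX t) Y hY
      rwa [star_exp, star_smul, (hsP hX).1, star_trivial, smul_neg] at this
  -- The basis is drawn from the conjugates themselves, so that each one-parameter group is a
  -- conjugate of one already in `H`.
  obtain ⟨b, hbc, hb, hlin⟩ := exists_linearIndependent ℝ c
  have : Fintype b := hlin.setFinite.fintype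
  have hx : ∀ i : b, ∀ t : ℝ, exp (t • (i : Matrix n n ℂ)) ∈ H := by
    rintro ⟨i, hi⟩ t
    obtain ⟨V, hV, X, hX, rfl⟩ := hbc hi
    have h₁ := Matrix.mem_unitaryGroup_iff.mp (hH V hV).1
    have h₂ := Matrix.mem_unitaryGroup_iff'.mp (hH V hV).1
    have := Matrix.exp_units_conj ⟨V, star V, h₁, h₂⟩ (t • X)
    simp only [Units.val_mk, Units.inv_mk, Matrix.mul_smul, Matrix.smul_mul] at this
    rw [this]
    exact mul_mem (mul_mem hV (hs X hX t)) (hstar V hV)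
  rw [← exp_unitaryLog hU]
  refine exp_mem_of_eventually (eventually_exp_smul_mem hH hx ?_
    (unitaryLog_mem_skewCommutant hU hUP))
  rw [Subtype.range_coe, hb]
  exact hW

end Generation

/-! ### From the group to the Lie algebra. -/

section Obstruction

open NormedSpace
open scoped Matrix.Norms.L2Operator ComplexOrder

variable {n : Type*} [Fintype n]

/-- `tr (X X) = -tr (X† X)`, so the trace form is negative definite on skew-Hermitian matrices. -/
theorem eq_zero_of_re_trace_mul_self {X : Matrix n n ℂ} (h : star X = -X)
    (h0 : (X * X).trace.re = 0) : X = 0 := by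
  rw [← Matrix.trace_conjTranspose_mul_self_eq_zero_iff, ← Matrix.star_eq_conjTranspose, h,
    neg_mul, Matrix.trace_neg, neg_eq_zero]
  refine Complex.ext h0 ?_
  have : star (X * X).trace = (X * X).trace := by
    rw [← Matrix.trace_conjTranspose, ← Matrix.star_eq_conjTranspose, star_mul, h, neg_mul_neg]
  exact Complex.conj_eq_iff_im.mp this

theorem trace_mul_eq_zero_of_re {X Y : Matrix n n ℂ} (hX : star X = -X) (hY : star Y = -Y)
    (h : (X * Y).trace.re = 0) : (X * Y).trace = 0 := by
  refine Complex.ext h ?_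
  have : star (X * Y).trace = (X * Y).trace := by
    rw [← Matrix.trace_conjTranspose, ← Matrix.star_eq_conjTranspose, star_mul, hX, hY,
      neg_mul_neg, Matrix.trace_mul_comm]
  exact Complex.conj_eq_iff_im.mp this

/-- The form `Re tr (X Y)`. -/
noncomputable def reTraceForm (n : Type*) [Fintype n] :
    LinearMap.BilinForm ℝ (Matrix n n ℂ) :=
  LinearMap.mk₂ ℝ (fun X Y => (X * Y).trace.re)
    (fun X Y Z => by simp [add_mul]) (fun c X Y => by simp)
    (fun X Y Z => by simp [mul_add]) (fun c X Y => by simp)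

theorem reTraceForm_apply (X Y : Matrix n n ℂ) : reTraceForm n X Y = (X * Y).trace.re := rfl

/-- A space of skew-Hermitian matrices without nonzero orthogonal vectors in a larger one is all of
the larger one. -/
theorem le_of_forall_orthogonal_eq_zero {L G : Submodule ℝ (Matrix n n ℂ)} (hLG : L ≤ G)
    (hG : ∀ X ∈ G, star X = -X)
    (h : ∀ Z ∈ G, (∀ Y ∈ L, (Y * Z).trace.re = 0) → Z = 0) : G ≤ L := by
  have hrefl : (reTraceForm n).IsRefl := fun X Y hXY => by
    rwa [reTraceForm_apply, Matrix.trace_mul_comm]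
  have hdis : Disjoint L ((reTraceForm n).orthogonal L) := by
    rw [Submodule.disjoint_def]
    intro X hX hX'
    exact eq_zero_of_re_trace_mul_self (hG X (hLG hX)) (hX' X hX)
  have hcompl := (LinearMap.BilinForm.isCompl_orthogonal_iff_disjoint hrefl).mpr hdis
  intro X hX
  obtain ⟨Y, hY, Z, hZ, rfl⟩ := Submodule.mem_sup.mp (hcompl.sup_eq_top ▸ Submodule.mem_top (x := X))
  have hZG : Z ∈ G := by simpa using G.sub_mem hX (hLG hY)
  rw [h Z hZG fun Y' hY' => hZ Y' hY', add_zero]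
  exact hY

variable [DecidableEq n]

/-- A matrix that commutes with the corner `Q M Q` of every matrix `M` acts on that corner as a
scalar. -/
theorem exists_mul_eq_smul_of_commute_corner {Z Q : Matrix n n ℂ}
    (h : ∀ M, Commute Z (Q * M * Q)) : ∃ c : ℂ, Z * Q = c • Q := by
  by_cases hQ : Q = 0
  · exact ⟨0, by simp [hQ]⟩
  obtain ⟨j, b, hjb⟩ : ∃ j b, Q j b ≠ 0 := by
    by_contra! hc
    exact hQ (Matrix.ext hc)
  have hs : ∀ (A B : Matrix n n ℂ) (i a : n),
      (A * Matrix.single i j (1 : ℂ) * B) a b = A a i * B j b := by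
    intro A B i a
    simp [Matrix.mul_apply, Matrix.single_apply, ite_and]
  -- Testing on the matrix unit `Eᵢⱼ` and reading entry `(a, b)` gives `(Z Q)ₐᵢ Qⱼᵦ = Qₐᵢ (Q Z)ⱼᵦ`,
  -- where `β` stands for `b`.
  refine ⟨(Q * Z) j b / Q j b, Matrix.ext fun a i => ?_⟩
  have := congrFun (congrFun (h (Matrix.single i j 1)).eq a) b
  rw [← mul_assoc, ← mul_assoc, mul_assoc _ Q Z, hs, hs] at this
  rw [Matrix.smul_apply, smul_eq_mul, div_mul_eq_mul_div, eq_div_iff hjb, this, mul_comm]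

variable {P : Matrix n n ℂ}

/-- The centre of the Lie algebra of skew-Hermitian matrices commuting with a rank one projection
`P` is contained in the span of `P` and `1`. -/
theorem exists_eq_smul_add_smul_one (hstar : star P = P)
    (hP : ∀ M, P * M * P = (P * M).trace • P) (hPP : P * P = P)
    {Z : Matrix n n ℂ} (hZP : Commute Z P) (hZ : ∀ X ∈ skewCommutant P, Commute X Z) :
    ∃ a b : ℂ, Z = a • P + b • (1 : Matrix n n ℂ) := by
  have hQ : ∀ M, Commute Z ((1 - P) * M * (1 - P)) := by
    -- For Hermitian `A`, the corner times `i` is skew-Hermitian and commutes with `P`; real and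
    -- imaginary parts then handle general `M`.
    have hsa : ∀ A : Matrix n n ℂ, star A = A → Commute Z ((1 - P) * A * (1 - P)) := by
      intro A hA
      have : Complex.I • ((1 - P) * A * (1 - P)) ∈ skewCommutant P := by
        refine ⟨?_, Commute.smul_left ?_ _⟩
        · simp [star_smul, star_mul, hA, hstar, mul_assoc]
        · rw [Commute, SemiconjBy]
          have h₁ : (1 - P) * P = 0 := by rw [sub_mul, one_mul, hPP, sub_self]
          have h₂ : P * (1 - P) = 0 := by rw [mul_sub, mul_one, hPP, sub_self]
          rw [mul_assoc, h₁, mul_zero, ← mul_assoc, ← mul_assoc, h₂, zero_mul, zero_mul]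
      have hc := (hZ _ this).symm.smul_right (-Complex.I)
      rwa [smul_smul, neg_mul, Complex.I_mul_I, neg_neg, one_smul] at hc
    intro M
    rw [← realPart_add_I_smul_imaginaryPart M]
    have h₁ := hsa _ (realPart M).2
    have h₂ := (hsa _ (imaginaryPart M).2).smul_right Complex.I
    rw [mul_add, add_mul, Matrix.mul_smul, Matrix.smul_mul]
    exact h₁.add_right h₂
  obtain ⟨b, hb⟩ := exists_mul_eq_smul_of_commute_corner hQ
  refine ⟨(P * Z).trace - b, b, ?_⟩
  have h₁ : Z * P = (P * Z).trace • P := by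
    rw [← hP, ← hZP.eq, mul_assoc, hPP]
  calc Z = Z * P + Z * (1 - P) := by noncomm_ring
    _ = _ := by rw [h₁, hb, smul_sub, sub_smul]; abel

/-- The eigenvalue on `P` and the determinant are two characters of the stabilizer; they turn
products into sums of traces, up to `2πi ℤ`. -/
theorem trace_mul_exp_list {l : List (Matrix n n ℂ)}
    (hP : ∀ M, P * M * P = (P * M).trace • P) (hPP : P * P = P)
    (hl : ∀ X ∈ l, X ∈ skewCommutant P) :
    P * (l.map exp).prod = Complex.exp (l.map fun X => (P * X).trace).sum • P ∧
      (l.map exp).prod.det = Complex.exp (l.map Matrix.trace).sum := by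
  induction l with
  | nil => simp
  | cons X l ih =>
    obtain ⟨ih₁, ih₂⟩ := ih fun Y hY => hl Y (List.mem_cons_of_mem _ hY)
    have hX := hl X List.mem_cons_self
    have hPX : P * X = (P * X).trace • P := by
      rw [← hP, mul_assoc, hX.2.eq, ← mul_assoc, hPP]
    simp only [List.map_cons, List.prod_cons, List.sum_cons, Complex.exp_add]
    constructor
    · rw [← mul_assoc, mul_exp_of_mul_eq_smul hPX, Matrix.smul_mul, ih₁, smul_smul]
    · rw [Matrix.det_mul, ih₂, det_exp_of_star_eq_neg hX.1]

/-- If all unitaries `exp (s Z)`, with `Z` in the span of `P` and `1`, are products of exponentials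
of elements that are orthogonal to `Z`, then `Z = 0`. -/
theorem eq_zero_of_forall_exp_eq_prod (hP : ∀ M, P * M * P = (P * M).trace • P)
    (hPP : P * P = P) (hP0 : P ≠ 0) {Z : Matrix n n ℂ} (hZ : Z ∈ skewCommutant P) {a b : ℂ}
    (hab : Z = a • P + b • (1 : Matrix n n ℂ))
    (h : ∀ s : ℝ, ∃ l : List (Matrix n n ℂ),
      (∀ X ∈ l, X ∈ skewCommutant P ∧ (Z * X).trace = 0) ∧ (l.map exp).prod = exp (s • Z)) :
    Z = 0 := by
  by_contra hne
  have hZZ : (Z * Z).trace ≠ 0 := fun h0 =>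
    hne (eq_zero_of_re_trace_mul_self hZ.1 (by rw [h0]; rfl))
  have htr : ∀ X, (Z * X).trace = a * (P * X).trace + b * X.trace := by
    intro X
    conv_lhs => rw [hab]
    simp [add_mul]
  have hsum : ∀ l : List (Matrix n n ℂ), (∀ X ∈ l, (Z * X).trace = 0) →
      a * (l.map fun X => (P * X).trace).sum + b * (l.map Matrix.trace).sum = 0 := by
    intro l hl
    induction l with
    | nil => simp
    | cons X l ih =>
      have h₁ := ih fun Y hY => hl Y (List.mem_cons_of_mem _ hY)
      have h₂ := hl X List.mem_cons_self
      rw [htr] at h₂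
      simp only [List.map_cons, List.sum_cons]
      linear_combination h₁ + h₂
  -- The integers record the `2πi` ambiguity of the two characters. Every real `s` would be a value
  -- of `f`, against uncountability of `ℝ`.
  let f : ℤ × ℤ → ℝ := fun p =>
    (-(a * (p.1 * (2 * Real.pi * Complex.I)) + b * (p.2 * (2 * Real.pi * Complex.I))) /
      (Z * Z).trace).re
  have hf : Function.Surjective f := by
    intro s
    obtain ⟨l, hl, hls⟩ := h s
    obtain ⟨h₁, h₂⟩ := trace_mul_exp_list hP hPP fun X hX => (hl X hX).1
    obtain ⟨h₃, h₄⟩ := trace_mul_exp_list (l := [s • Z]) hP hPP (by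
      simpa using LieSubalgebra.smul_mem _ s hZ)
    simp only [List.map_cons, List.map_nil, List.prod_singleton, List.sum_singleton] at h₃ h₄
    rw [hls, h₃] at h₁
    rw [hls, h₄] at h₂
    obtain ⟨j, hj⟩ := Complex.exp_eq_exp_iff_exists_int.mp (smul_left_injective ℂ hP0 h₁)
    obtain ⟨k, hk⟩ := Complex.exp_eq_exp_iff_exists_int.mp h₂
    refine ⟨(-j, -k), ?_⟩
    have h₅ := hsum l fun X hX => (hl X hX).2
    have h₆ := htr (s • Z)
    have h₇ : (Z * s • Z).trace = s * (Z * Z).trace := by simp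
    have h₈ : (s : ℂ) = -(a * (((-j : ℤ) : ℂ) * (2 * Real.pi * Complex.I)) +
        b * (((-k : ℤ) : ℂ) * (2 * Real.pi * Complex.I))) / (Z * Z).trace := by
      rw [eq_div_iff hZZ, ← h₇, h₆, hj, hk]
      push_cast
      linear_combination h₅
    change (-(a * (((-j : ℤ) : ℂ) * (2 * Real.pi * Complex.I)) +
        b * (((-k : ℤ) : ℂ) * (2 * Real.pi * Complex.I))) / (Z * Z).trace).re = s
    rw [← h₈, Complex.ofReal_re]
  exact not_countable hf.countable

/-- If every unitary commuting with the rank one projection `P` is a product of exponentials of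
elements of `L`, then `L` contains every skew-Hermitian matrix commuting with `P`. -/
theorem skewCommutant_le_of_forall_eq_prod (hstar : star P = P)
    (hP : ∀ M, P * M * P = (P * M).trace • P) (hPP : P * P = P) (hP0 : P ≠ 0)
    {L : LieSubalgebra ℝ (Matrix n n ℂ)} (hL : L ≤ skewCommutant P)
    (h : ∀ U ∈ Matrix.unitaryGroup n ℂ, Commute U P →
      ∃ l : List (Matrix n n ℂ), (∀ X ∈ l, X ∈ L) ∧ (l.map exp).prod = U) :
    skewCommutant P ≤ L := by
  have hAd : ∀ U ∈ Matrix.unitaryGroup n ℂ, Commute U P → ∀ Y ∈ L, U * Y * star U ∈ L := by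
    intro U hU hUP
    obtain ⟨l, hl, rfl⟩ := h U hU hUP
    clear hU hUP
    induction l with
    | nil => simp
    | cons X l ih =>
      intro Y hY
      have hX := hl X List.mem_cons_self
      have h₁ := ih (fun Z hZ => hl Z (List.mem_cons_of_mem _ hZ)) Y hY
      have h₂ := exp_mul_mul_exp_neg_mem (W := L.toSubmodule) (X := X)
        (fun Z hZ => L.lie_mem hX hZ) h₁
      rw [List.map_cons, List.prod_cons, star_mul, star_exp, (hL hX).1]
      simpa only [mul_assoc, LieSubalgebra.mem_toSubmodule] using h₂
  have hideal : ∀ X ∈ skewCommutant P, ∀ Y ∈ L, X * Y - Y * X ∈ L := by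
    intro X hX Y hY
    refine commutator_mem_of_forall_exp (W := L.toSubmodule) fun t => ?_
    have := hAd _ (exp_smul_mem_unitaryGroup hX t) (hX.2.smul_left t).exp_left Y hY
    rwa [star_exp, star_smul, hX.1, star_trivial, smul_neg] at this
  refine le_of_forall_orthogonal_eq_zero (L := L.toSubmodule) (G := (skewCommutant P).toSubmodule)
    hL (fun X hX => hX.1) fun Z hZ horth => ?_
  -- With `C = [Z, Y]` in the ideal `L`, invariance gives `tr (C C) = tr ([Y, C] Z)`, whose real
  -- part vanishes by orthogonality; definiteness yields `C = 0`.
  have hZL : ∀ Y ∈ L, Commute Y Z := by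
    intro Y hY
    have hC := hideal Z hZ Y hY
    have h₀ := horth _ (L.lie_mem hY hC)
    refine (sub_eq_zero.mp (eq_zero_of_re_trace_mul_self (hL hC).1 ?_)).symm
    have htr : ∀ C : Matrix n n ℂ,
        (C * (Z * Y - Y * Z)).trace = ((Y * C - C * Y) * Z).trace := fun C => by
      rw [mul_sub, sub_mul, Matrix.trace_sub, Matrix.trace_sub, ← mul_assoc C Z Y,
        Matrix.trace_mul_comm (C * Z) Y, ← mul_assoc, ← mul_assoc]
    rw [htr]
    exact h₀
  have hexp : ∀ l : List (Matrix n n ℂ), (∀ X ∈ l, X ∈ L) → Commute (l.map exp).prod Z := by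
    intro l hl
    refine Commute.list_prod_left _ _ fun U hU => ?_
    obtain ⟨X, hX, rfl⟩ := List.mem_map.mp hU
    exact (hZL X (hl X hX)).exp_left
  have hcenter : ∀ X ∈ skewCommutant P, Commute X Z := fun X hX =>
    commute_of_forall_commute_exp fun t => by
      obtain ⟨l, hl, hlX⟩ := h _ (exp_smul_mem_unitaryGroup hX t) (hX.2.smul_left t).exp_left
      exact hlX ▸ hexp l hl
  obtain ⟨a, b, hab⟩ := exists_eq_smul_add_smul_one hstar hP hPP hZ.2 hcenter
  refine eq_zero_of_forall_exp_eq_prod hP hPP hP0 hZ hab fun s => ?_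
  obtain ⟨l, hl, hls⟩ := h _ (exp_smul_mem_unitaryGroup hZ s) (hZ.2.smul_left s).exp_left
  refine ⟨l, fun X hX => ⟨hL (hl X hX), ?_⟩, hls⟩
  rw [Matrix.trace_mul_comm]
  exact trace_mul_eq_zero_of_re (hL (hl X hX)).1 hZ.1 (horth X (hl X hX))

end Obstruction

/-! ### The rank-one projection. -/

section Ketbra

variable {n : Type*}

theorem star_ketbra (ψ : EuclideanSpace ℂ n) : star (ketbra ψ) = ketbra ψ := by
  ext i j
  simp [ketbra, Matrix.vecMulVec_apply, mul_comm]

theorem trace_ketbra [Fintype n] {ψ : EuclideanSpace ℂ n} (hψ : ‖ψ‖ = 1) : (ketbra ψ).trace = 1 := by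
  have h := EuclideanSpace.norm_sq_eq ψ
  rw [hψ, one_pow] at h
  simp only [ketbra, Matrix.trace_vecMulVec, dotProduct, Complex.star_def, Complex.mul_conj,
    Complex.normSq_eq_norm_sq]
  exact_mod_cast h.symm

theorem ketbra_mul_mul_ketbra [Fintype n] (ψ : EuclideanSpace ℂ n) (M : Matrix n n ℂ) :
    ketbra ψ * M * ketbra ψ = (ketbra ψ * M).trace • ketbra ψ := by
  rw [ketbra, Matrix.vecMulVec_mul, Matrix.vecMulVec_mul_vecMulVec, Matrix.trace_vecMulVec]
  rw [Matrix.vecMulVec_smul, dotProduct_comm]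

theorem ketbra_mul_ketbra [Fintype n] [DecidableEq n] {ψ : EuclideanSpace ℂ n} (hψ : ‖ψ‖ = 1) :
    ketbra ψ * ketbra ψ = ketbra ψ := by
  have := ketbra_mul_mul_ketbra ψ 1
  rwa [mul_one, trace_ketbra hψ, one_smul] at this

theorem ketbra_ne_zero [Fintype n] {ψ : EuclideanSpace ℂ n} (hψ : ‖ψ‖ = 1) : ketbra ψ ≠ 0 := by
  intro h
  have := trace_ketbra hψ
  rw [h, Matrix.trace_zero] at this
  exact zero_ne_one this

end Ketbra

end QuasiLocal

/-! ### The equivalence. -/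

theorem mainTheorem3 {N K : ℕ} (d : Fin N → ℕ) (nbhd : Fin K → Finset (Fin N))
    (ψ : EuclideanSpace ℂ (QuasiLocal.Config d)) (hψ : ‖ψ‖ = 1) :
    (∀ U ∈ QuasiLocal.unitaryStabilizer ψ,
      ∃ l : List (Matrix.unitaryGroup (QuasiLocal.Config d) ℂ),
        (∀ V ∈ l, ∃ k : Fin K, V ∈ QuasiLocal.nbhdUnitaryStabilizer d (nbhd k) ψ) ∧
          l.prod = U) ↔
    (LieSubalgebra.lieSpan ℝ (Matrix (QuasiLocal.Config d) (QuasiLocal.Config d) ℂ)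
        (⋃ k : Fin K,
          QuasiLocal.lieAlgebraOf (QuasiLocal.nbhdUnitaryStabilizer d (nbhd k) ψ)) :
      Set (Matrix (QuasiLocal.Config d) (QuasiLocal.Config d) ℂ)) =
    QuasiLocal.lieAlgebraOf (QuasiLocal.unitaryStabilizer ψ) := by
  open QuasiLocal in
  rw [lieAlgebraOf_unitaryStabilizer]
  have hle : LieSubalgebra.lieSpan ℝ (Matrix (Config d) (Config d) ℂ)
      (⋃ k : Fin K, lieAlgebraOf (nbhdUnitaryStabilizer d (nbhd k) ψ)) ≤
      skewCommutant (ketbra ψ) := by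
    rw [LieSubalgebra.lieSpan_le, Set.iUnion_subset_iff, ← lieAlgebraOf_unitaryStabilizer]
    exact fun k => lieAlgebraOf_mono inf_le_right
  constructor
  · intro h
    refine congrArg _ (le_antisymm hle ?_)
    refine skewCommutant_le_of_forall_eq_prod (star_ketbra ψ) (ketbra_mul_mul_ketbra ψ)
      (ketbra_mul_ketbra hψ) (ketbra_ne_zero hψ) hle fun U hU hUP => ?_
    obtain ⟨l, hl, hlU⟩ := h ⟨U, hU⟩ (mem_unitaryStabilizer_iff.mpr hUP)
    refine ⟨l.map fun V : Matrix.unitaryGroup (Config d) ℂ =>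
      unitaryLog (V : Matrix (Config d) (Config d) ℂ), fun X hX => ?_, ?_⟩
    · obtain ⟨V, hV, rfl⟩ := List.mem_map.mp hX
      obtain ⟨k, hk⟩ := hl V hV
      exact LieSubalgebra.subset_lieSpan
        (Set.mem_iUnion.mpr ⟨k, unitaryLog_mem_lieAlgebraOf_nbhd d (nbhd k) hk⟩)
    · rw [List.map_map]
      have e : (l.map (NormedSpace.exp ∘ fun V : Matrix.unitaryGroup (Config d) ℂ =>
          unitaryLog (V : Matrix (Config d) (Config d) ℂ))) =
          l.map (Matrix.unitaryGroup (Config d) ℂ).subtype :=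
        List.map_congr_left fun V _ => exp_unitaryLog V.2
      rw [e, ← map_list_prod, hlU]
      rfl
  · intro h U hU
    -- A submonoid closure matches finite products exactly; it is closed under inverses because each
    -- generating family is a group.
    let G : Submonoid (Matrix.unitaryGroup (Config d) ℂ) :=
      Submonoid.closure {V | ∃ k : Fin K, V ∈ nbhdUnitaryStabilizer d (nbhd k) ψ}
    have hG : G ≤ (unitaryStabilizer ψ).toSubmonoid :=
      Submonoid.closure_le.mpr fun V ⟨k, hV⟩ => hV.2
    have hinv : ∀ V ∈ G, V⁻¹ ∈ G := by
      intro V hV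
      induction hV using Submonoid.closure_induction with
      | mem V hV =>
        obtain ⟨k, hk⟩ := hV
        exact Submonoid.subset_closure ⟨k, inv_mem hk⟩
      | one => simp
      | mul V W _ _ hV hW =>
        rw [mul_inv_rev]
        exact mul_mem hW hV
    have hUG : (U : Matrix (Config d) (Config d) ℂ) ∈
        G.map (Matrix.unitaryGroup (Config d) ℂ).subtype := by
      refine mem_of_lieSpan_eq (P := ketbra ψ) ?_ ?_ ?_ (SetLike.coe_injective h) U.2
        (mem_unitaryStabilizer_iff.mp hU)
      · rintro _ ⟨V, hV, rfl⟩
        exact ⟨V.2, mem_unitaryStabilizer_iff.mp (hG hV)⟩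
      · rintro _ ⟨V, hV, rfl⟩
        exact ⟨V⁻¹, hinv V hV, rfl⟩
      · intro X hX t
        obtain ⟨k, hk⟩ := Set.mem_iUnion.mp hX
        obtain ⟨V, hV, hVX⟩ := hk t
        exact ⟨V, Submonoid.subset_closure ⟨k, hV⟩, hVX⟩
    obtain ⟨V, hV, hVU⟩ := hUG
    obtain rfl : V = U := Subtype.ext hVU
    exact Submonoid.exists_list_of_mem_closure hV
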